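/- Let $p$ be a prime, $K\ge 1$ and $d, m_1,\dots,m_K,m'_1,\dots,m'_K\ge 0$ integers. An LCBC instance over a finite field $\mathbb F_q$ consists of matrices $\mathbf v_k\in\mathbb F_q^{d\times m_k}$ (demand of user $k$) and $\mathbf v'_k\in\mathbb F_q^{d\times m'_k}$ (side-information of user $k$), $k\in[K]=\{1,\dots,K\}$. A coding scheme consists of a batch size $L\ge 1$, a finite alphabet $\mathcal S$, an encoder $\Phi:\mathbb F_q^{d\times L}\to\mathcal S$ and decoders $\Psi_k:\mathcal S\times\mathbb F_q^{L\times m'_k}\to\mathbb F_q^{L\times m_k}$, $k\in[K]$, none of them necessarily linear. It is achievable for the instance if $\Psi_k(\Phi(\mathbf x),\mathbf x^T\mathbf v'_k)=\mathbf x^T\mathbf v_k$ for all $\mathbf x\in\mathbb F_q^{d\times L}$ and all $k\in[K]$. Its broadcast cost is $\log_q|\mathcal S|/L$, and the optimal broadcast cost $\Delta^*(\Lambda)$ of an instance $\Lambda$ is the infimum of the costs of all schemes that are achievable for it. With $(p,K,d,m_{[K]},m'_{[K]})$ fixed, let $\Lambda_n$ be uniformly distributed on the finite set of all LCBC instances over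 $\mathbb F_{p^n}$ with these dimensions, and put $$\Delta_u^*=\inf\Big\{\Delta\in\mathbb R:\lim_{n\to\infty}\Pr\big(\Delta^*(\Lambda_n)\le\Delta\big)=1\Big\},\qquad \Delta_l^*=\sup\Big\{\Delta\in\mathbb R:\lim_{n\to\infty}\Pr\big(\Delta^*(\Lambda_n)>\Delta\big)=1\Big\}.$$ Then $$\Delta_l^*\ \ge\ \max_{\mathcal K\subseteq[K]}\ \min\Big\{d-\sum_{k\in\mathcal K}m'_k,\ \sum_{k\in\mathcal K}m_k\Big\},$$ $$\Delta_u^*\ \le\ \min\Big\{\frac{m_{\max}\,d}{m_{\max}+m'_{\min}},\ (d-m'_{\min})^+,\ \sum_{k\in[K]}m_k\Big\},$$ where $m_{\max}=\max_{k\in[K]}m_k$, $m'_{\min}=\min_{k\in[K]}m'_k$, $(x)^+=\max\{0,x\}$, and the quotient is read as $0$ if $m_{\max}=m'_{\min}=0$. -/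

import Mathlib

open Filter Topology

/-! # The linear computation broadcast (LCBC) problem and its generic broadcast cost -/

namespace LCBC

/-- An LCBC instance with `K` users over a field `F`: the coefficient matrices of the desired
computations `v k ∈ F^{d × m_k}` and of the side-informations `v' k ∈ F^{d × m'_k}`. -/
@[ext]
structure Instance (F : Type) (K d : ℕ) (m m' : Fin K → ℕ) where
  v : (k : Fin K) → Matrix (Fin d) (Fin (m k)) F
  v' : (k : Fin K) → Matrix (Fin d) (Fin (m' k)) F

/-- A (not necessarily linear) coding scheme: a batch size `L ≥ 1`, a finite broadcast alphabet,
an encoder acting on the data `x ∈ F^{d × L}`, and one decoder for each user, acting on the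
broadcast symbol and that user's side-information. -/
structure Scheme (F : Type) (K d : ℕ) (m m' : Fin K → ℕ) where
  L : ℕ
  L_pos : 0 < L
  alphabet : Type
  finite_alphabet : Finite alphabet
  encode : Matrix (Fin d) (Fin L) F → alphabet
  decode : (k : Fin K) → alphabet → Matrix (Fin L) (Fin (m' k)) F → Matrix (Fin L) (Fin (m k)) F

/-- The broadcast cost `log_q |S| / L`, where `q = |F|`. -/
noncomputable def Scheme.cost {F : Type} {K d : ℕ} {m m' : Fin K → ℕ}
    (s : Scheme F K d m m') : ℝ :=
  Real.logb (Nat.card F) (Nat.card s.alphabet) / s.L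

/-- For every data realization `x`, every user `k` recovers `xᵀ v_k` from the broadcast symbol and
its side-information `xᵀ v'_k`. -/
def Scheme.IsAchievable {F : Type} [Field F] {K d : ℕ} {m m' : Fin K → ℕ}
    (s : Scheme F K d m m') (Λ : Instance F K d m m') : Prop :=
  ∀ (x : Matrix (Fin d) (Fin s.L) F) (k : Fin K),
    s.decode k (s.encode x) (x.transpose * Λ.v' k) = x.transpose * Λ.v k

/-- The costs of all achievable schemes of an instance. -/
def costs {F : Type} [Field F] {K d : ℕ} {m m' : Fin K → ℕ} (Λ : Instance F K d m m') : Set ℝ :=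
  {Δ | ∃ s : Scheme F K d m m', s.IsAchievable Λ ∧ s.cost = Δ}

/-- The optimal broadcast cost `Δ*(Λ)`. -/
noncomputable def optimalCost {F : Type} [Field F] {K d : ℕ} {m m' : Fin K → ℕ}
    (Λ : Instance F K d m m') : ℝ :=
  sInf (costs Λ)

/-- The probability that an instance, uniformly chosen among the finitely many instances over
`𝔽_{p^n}` with the given dimensions, has the property `E`. -/
noncomputable def prob (p : ℕ) [Fact p.Prime] (n K d : ℕ) (m m' : Fin K → ℕ)
    (E : Instance (GaloisField p n) K d m m' → Prop) : ℝ :=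
  (Nat.card {Λ : Instance (GaloisField p n) K d m m' // E Λ} : ℝ) /
    Nat.card (Instance (GaloisField p n) K d m m')

/-- `Δ*(Λ_n) ≤ Δ` asymptotically almost surely as `n → ∞`. -/
def AasLe (p : ℕ) [Fact p.Prime] (K d : ℕ) (m m' : Fin K → ℕ) (Δ : ℝ) : Prop :=
  Tendsto (fun n : ℕ => prob p n K d m m' (fun Λ => optimalCost Λ ≤ Δ)) atTop (𝓝 1)

/-- `Δ*(Λ_n) > Δ` asymptotically almost surely as `n → ∞`. -/
def AasGt (p : ℕ) [Fact p.Prime] (K d : ℕ) (m m' : Fin K → ℕ) (Δ : ℝ) : Prop :=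
  Tendsto (fun n : ℕ => prob p n K d m m' (fun Λ => Δ < optimalCost Λ)) atTop (𝓝 1)

/-- `Δ_u*`: the infimum of the costs that are achievable asymptotically almost surely. -/
noncomputable def upperCost (p : ℕ) [Fact p.Prime] (K d : ℕ) (m m' : Fin K → ℕ) : ℝ :=
  sInf {Δ : ℝ | AasLe p K d m m' Δ}

/-- `Δ_l*`: the supremum of the costs that are not achievable asymptotically almost surely. -/
noncomputable def lowerCost (p : ℕ) [Fact p.Prime] (K d : ℕ) (m m' : Fin K → ℕ) : ℝ :=
  sSup {Δ : ℝ | AasGt p K d m m' Δ}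

/-! The infima and suprema above are taken over non-empty sets that are bounded on the relevant
side, so that they are genuine infima and suprema. -/

section WellDefined

variable {F : Type} [Field F] [Finite F] {K d : ℕ} {m m' : Fin K → ℕ}

theorem Scheme.cost_nonneg (s : Scheme F K d m m') : 0 ≤ s.cost := by
  have := s.finite_alphabet
  have : Nonempty s.alphabet := ⟨s.encode 0⟩
  have hF : (1 : ℝ) < Nat.card F := by exact_mod_cast Finite.one_lt_card
  have hS : (1 : ℝ) ≤ Nat.card s.alphabet := by exact_mod_cast Nat.card_pos
  exact div_nonneg (Real.logb_nonneg hF hS) (Nat.cast_nonneg _)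

theorem costs_bddBelow (Λ : Instance F K d m m') : BddBelow (costs Λ) :=
  ⟨0, by rintro _ ⟨s, _, rfl⟩; exact s.cost_nonneg⟩

/-- Broadcasting the whole data has cost `d`. -/
theorem dim_mem_costs (Λ : Instance F K d m m') : (d : ℝ) ∈ costs Λ := by
  have hF : (1 : ℝ) < Nat.card F := by exact_mod_cast Finite.one_lt_card
  refine ⟨⟨1, one_pos, Matrix (Fin d) (Fin 1) F, inferInstance, id,
    fun k x _ => x.transpose * Λ.v k⟩, fun x k => rfl, ?_⟩
  have : Nat.card (Matrix (Fin d) (Fin 1) F) = Nat.card F ^ d := by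
    simp [Matrix, Nat.card_fun]
  simp only [Scheme.cost, this, Nat.cast_pow, Nat.cast_one, div_one]
  rw [Real.logb_pow, Real.logb_self_eq_one hF, mul_one]

theorem optimalCost_nonneg (Λ : Instance F K d m m') : 0 ≤ optimalCost Λ :=
  le_csInf ⟨_, dim_mem_costs Λ⟩ (by rintro _ ⟨s, _, rfl⟩; exact s.cost_nonneg)

theorem optimalCost_le_dim (Λ : Instance F K d m m') : optimalCost Λ ≤ d :=
  csInf_le (costs_bddBelow Λ) (dim_mem_costs Λ)

instance : Finite (Instance F K d m m') :=
  Finite.of_injective (fun Λ => (Λ.v, Λ.v')) fun Λ Λ' h => by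
    cases Λ; cases Λ'; simpa using h

instance : Nonempty (Instance F K d m m') := ⟨⟨fun _ => 0, fun _ => 0⟩⟩

end WellDefined

section WellDefined

variable (p : ℕ) [Fact p.Prime] (K d : ℕ) (m m' : Fin K → ℕ)

theorem prob_of_forall (n : ℕ) {E : Instance (GaloisField p n) K d m m' → Prop} (h : ∀ Λ, E Λ) :
    prob p n K d m m' E = 1 := by
  have : Nat.card {Λ : Instance (GaloisField p n) K d m m' // E Λ} =
      Nat.card (Instance (GaloisField p n) K d m m') :=
    Nat.card_congr (Equiv.subtypeUnivEquiv h)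
  rw [prob, this, div_self]
  exact_mod_cast Nat.card_pos.ne'

theorem prob_of_forall_not (n : ℕ) {E : Instance (GaloisField p n) K d m m' → Prop}
    (h : ∀ Λ, ¬ E Λ) : prob p n K d m m' E = 0 := by
  have : IsEmpty {Λ : Instance (GaloisField p n) K d m m' // E Λ} := ⟨fun Λ => h _ Λ.2⟩
  simp [prob]

theorem aasLe_nonempty : {Δ : ℝ | AasLe p K d m m' Δ}.Nonempty :=
  ⟨d, by simp [AasLe, prob_of_forall, optimalCost_le_dim]⟩

theorem aasLe_bddBelow : BddBelow {Δ : ℝ | AasLe p K d m m' Δ} := by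
  refine ⟨0, fun Δ hΔ => ?_⟩
  by_contra! h
  have : ∀ n, prob p n K d m m' (fun Λ => optimalCost Λ ≤ Δ) = 0 := fun n =>
    prob_of_forall_not p K d m m' n fun Λ => not_le.2 (h.trans_le (optimalCost_nonneg Λ))
  simp [AasLe, this] at hΔ

theorem aasGt_nonempty : {Δ : ℝ | AasGt p K d m m' Δ}.Nonempty := by
  refine ⟨-1, ?_⟩
  have : ∀ n, prob p n K d m m' (fun Λ => -1 < optimalCost Λ) = 1 := fun n =>
    prob_of_forall p K d m m' n fun Λ => neg_one_lt_zero.trans_le (optimalCost_nonneg Λ)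
  simp [AasGt, this]

theorem aasGt_bddAbove : BddAbove {Δ : ℝ | AasGt p K d m m' Δ} := by
  refine ⟨d, fun Δ hΔ => ?_⟩
  by_contra! h
  have : ∀ n, prob p n K d m m' (fun Λ => Δ < optimalCost Λ) = 0 := fun n =>
    prob_of_forall_not p K d m m' n fun Λ => not_lt.2 ((optimalCost_le_dim Λ).trans h.le)
  simp [AasGt, this] at hΔ

end WellDefined

/-- `m_max`, the largest of finitely many (at least one) numbers. -/
def maxOf {K : ℕ} [NeZero K] (m : Fin K → ℕ) : ℕ :=
  Finset.univ.sup' Finset.univ_nonempty m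

/-- `m'_min`, the smallest of finitely many (at least one) numbers. -/
def minOf {K : ℕ} [NeZero K] (m' : Fin K → ℕ) : ℕ :=
  Finset.univ.inf' Finset.univ_nonempty m'

end LCBC

namespace LCBC

/-! For fixed `t`, a uniform `t × t` matrix over `𝔽_{p^n}` is invertible with probability tending to
1, so fixed square submatrices of the instance may be taken invertible.

Lower bound (`Scheme.IsAchievable.le_cost`). Choose `t = min(d, ∑ (m_k + m'_k))` columns belonging
to the users in `𝒦`, and support the data on `t` rows where these columns form an invertible matrix.
The broadcast together with the side-information of `𝒦` determines every chosen column product,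
hence the data. Counting gives `q^(tL) ≤ |S| q^(L ∑ m'_k)`, also for nonlinear schemes.

Upper bounds. Sending all demands costs `∑ m_k`; sending the symbols outside `min(d, m'_min)` rows
on which every user's side-information is invertible costs `(d - m'_min)^+`. The quotient comes from
interference alignment. By monotonicity (`AasLe.mono`) all users may have the same dimensions `m`,
`m'`. Let `T_k` be a square block of `V_k = [v_k v'_k]`, so that `V_k T_k⁻¹` consists of an identity
block and a block `H_k`. View `F = 𝔽_{p^n}` as an `n`-dimensional space over `𝔽_p`. There are
subspaces `W ≤ U` of `F`, both of dimension about `n m/(m+m')`, such that all entries of the `H_k`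
map `W` into `U` (`exists_almost_invariant`). Broadcast `l(u x_i)` for all `u ∈ U` and all `i`,
where `l` is a nonzero functional; this costs about `d m/(m+m')`. For `w ∈ W^(m+m')` the vector `V_k
T_k⁻¹ w` lies in `U^d`, so user `k` learns `l(xᵀ V_k T_k⁻¹ w)`. After removal of the
side-information this is a functional of the demand, and these functionals nearly span if no nonzero
`(0, b)` is sent into `W^(m+m')` by `T_k`; a small supplement completes them
(`optimalCost_le_of_alignment`).

The condition on `b` fails rarely: `W` depends only on the `H_k`, and given these the `T_k` are
still as random as before, so a union bound applies (`density_alignment_failure_le`). -/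

/-! ### Proportions of elements of finite types -/

section Density

/-- The proportion of the elements of a finite type that have the property `P`. -/
noncomputable def density {X : Type*} (P : X → Prop) : ℝ :=
  (Nat.card {x // P x} : ℝ) / Nat.card X

theorem density_nonneg {X : Type*} (P : X → Prop) : 0 ≤ density P := by
  unfold density; positivity

theorem density_mono {X : Type*} [Finite X] {P Q : X → Prop} (h : ∀ x, P x → Q x) :
    density P ≤ density Q := by
  unfold density
  gcongr
  exact Nat.card_le_card_of_injective (Subtype.map id h) (Subtype.map_injective h Function.injective_id)

theorem density_le_one {X : Type*} [Finite X] (P : X → Prop) : density P ≤ 1 := by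
  refine div_le_one_of_le₀ ?_ (Nat.cast_nonneg _)
  exact_mod_cast Nat.card_le_card_of_injective _ Subtype.val_injective

theorem density_not {X : Type*} [Finite X] [Nonempty X] (P : X → Prop) :
    density (fun x => ¬ P x) = 1 - density P := by
  classical
  have h : Nat.card X = Nat.card {x // P x} + Nat.card {x // ¬ P x} := by
    rw [← Nat.card_sum]
    exact Nat.card_congr (Equiv.sumCompl P).symm
  have h0 : (Nat.card X : ℝ) ≠ 0 := by exact_mod_cast Nat.card_pos.ne'
  unfold density
  rw [eq_sub_iff_add_eq, ← add_div, div_eq_one_iff_eq h0, h]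
  push_cast; ring

theorem density_exists_le {X ι : Type*} [Finite X] [Fintype ι] (P : ι → X → Prop) :
    density (fun x => ∃ i, P i x) ≤ ∑ i, density (P i) := by
  unfold density
  rw [← Finset.sum_div]
  gcongr
  have h : Nat.card {x // ∃ i, P i x} ≤ Nat.card (Σ i, {x // P i x}) := by
    refine Nat.card_le_card_of_injective
      (fun x => ⟨x.2.choose, x.1, x.2.choose_spec⟩) fun x y hxy => ?_
    have := congrArg (fun z : Σ i, {x // P i x} => z.2.1) hxy
    exact Subtype.ext this
  rw [Nat.card_sigma] at h
  exact_mod_cast h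

theorem density_or_le {X : Type*} [Finite X] (P Q : X → Prop) :
    density (fun x => P x ∨ Q x) ≤ density P + density Q := by
  refine (density_mono fun x hx => ?_).trans
    ((density_exists_le fun i : Bool => cond i P Q).trans_eq (by simp))
  exact hx.elim (fun h => ⟨true, h⟩) fun h => ⟨false, h⟩

theorem density_comp_equiv {X Y : Type*} (e : X ≃ Y) (P : Y → Prop) :
    density (fun x => P (e x)) = density P := by
  unfold density
  rw [Nat.card_congr e, Nat.card_congr (e.subtypeEquiv (q := P) fun _ => Iff.rfl)]

theorem density_comp_fst {Y Z : Type*} [Finite Z] [Nonempty Z] (P : Y → Prop) :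
    density (fun x : Y × Z => P x.1) = density P := by
  have h0 : (Nat.card Z : ℝ) ≠ 0 := by exact_mod_cast Nat.card_pos.ne'
  unfold density
  have : Nat.card {x : Y × Z // P x.1} = Nat.card {y // P y} * Nat.card Z := by
    rw [← Nat.card_prod]
    exact Nat.card_congr
      ⟨fun x => (⟨x.1.1, x.2⟩, x.1.2), fun y => ⟨(y.1.1, y.2), y.1.2⟩, fun _ => rfl, fun _ => rfl⟩
  rw [this, Nat.card_prod]
  push_cast
  rw [mul_div_mul_right _ _ h0]

/-- A surjective homomorphism of finite groups preserves proportions. -/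
theorem density_comp_of_surjective {X Y : Type*} [AddCommGroup X] [AddCommGroup Y] [Finite X]
    (f : X →+ Y) (hf : Function.Surjective f) (P : Y → Prop) :
    density (fun x => P (f x)) = density P := by
  -- A set-theoretic section `g` is enough: it splits `X` as `Y × ker f` as a set.
  obtain ⟨g, hg⟩ := hf.hasRightInverse
  let e : X ≃ Y × f.ker :=
    { toFun := fun x => (f x, ⟨x - g (f x), by simp [AddMonoidHom.mem_ker, hg (f x)]⟩)
      invFun := fun y => g y.1 + y.2.1
      left_inv := fun x => by simp
      right_inv := fun y => by
        have : f (y.2 : X) = 0 := y.2.2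
        ext <;> simp [this, hg y.1] }
  exact (density_comp_equiv e fun y => P y.1).trans (density_comp_fst P)

/-- If the proportion is at most `δ` on each fibre of a product, it is at most `δ`. -/
theorem density_prod_le {X Y : Type*} [Finite X] [Finite Y] [Nonempty Y] {δ : ℝ}
    (P : X × Y → Prop) (h : ∀ y, density (fun x => P (x, y)) ≤ δ) : density P ≤ δ := by
  have := Fintype.ofFinite Y
  have hY : (0 : ℝ) < Nat.card Y := by exact_mod_cast Nat.card_pos
  have hc : Nat.card {z // P z} = ∑ y, Nat.card {x // P (x, y)} := by
    rw [← Nat.card_sigma]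
    exact Nat.card_congr ⟨fun z => ⟨z.1.2, z.1.1, z.2⟩, fun w => ⟨(w.2.1, w.1), w.2.2⟩,
      fun _ => rfl, fun _ => rfl⟩
  have : density P = (∑ y, density (fun x => P (x, y))) / Nat.card Y := by
    unfold density
    rw [hc, ← Finset.sum_div, Nat.card_prod]
    push_cast
    rw [div_div]
  rw [this, div_le_iff₀ hY]
  refine (Finset.sum_le_sum fun y _ => h y).trans ?_
  simp [mul_comm]

/-- The proportion of the solutions of `f x = y` for a surjective homomorphism `f`. -/
theorem density_eq_of_surjective {X Y : Type*} [AddCommGroup X] [AddCommGroup Y] [Finite X]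
    (f : X →+ Y) (hf : Function.Surjective f) (y : Y) :
    density (fun x => f x = y) = (Nat.card Y : ℝ)⁻¹ := by
  rw [density_comp_of_surjective f hf (fun z => z = y)]
  simp [density]

theorem tendsto_density_of_not {X : ℕ → Type*} [∀ n, Finite (X n)] [∀ n, Nonempty (X n)]
    (P : (n : ℕ) → X n → Prop)
    (h : Tendsto (fun n => density (fun x => ¬ P n x)) atTop (𝓝 0)) :
    Tendsto (fun n => density (P n)) atTop (𝓝 1) := by
  have := h.const_sub 1
  simpa [density_not] using this

theorem tendsto_density_not {X : ℕ → Type*} [∀ n, Finite (X n)] [∀ n, Nonempty (X n)]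
    (P : (n : ℕ) → X n → Prop)
    (h : Tendsto (fun n => density (P n)) atTop (𝓝 1)) :
    Tendsto (fun n => density (fun x => ¬ P n x)) atTop (𝓝 0) := by
  have := h.const_sub 1
  simpa [density_not] using this

theorem tendsto_density_mono {X : ℕ → Type*} [∀ n, Finite (X n)]
    {P Q : (n : ℕ) → X n → Prop} (h : Tendsto (fun n => density (P n)) atTop (𝓝 1))
    (hPQ : ∀ᶠ n in atTop, ∀ x, P n x → Q n x) :
    Tendsto (fun n => density (Q n)) atTop (𝓝 1) :=
  tendsto_of_tendsto_of_tendsto_of_le_of_le' h tendsto_const_nhds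
    (hPQ.mono fun _ hn => density_mono hn) (Eventually.of_forall fun _ => density_le_one _)

theorem tendsto_density_forall {X : ℕ → Type*} [∀ n, Finite (X n)] [∀ n, Nonempty (X n)]
    {ι : Type*} [Fintype ι] (P : (n : ℕ) → ι → X n → Prop)
    (h : ∀ i, Tendsto (fun n => density (P n i)) atTop (𝓝 1)) :
    Tendsto (fun n => density (fun x => ∀ i, P n i x)) atTop (𝓝 1) := by
  refine tendsto_density_of_not _ ?_
  have h0 : Tendsto (fun n => ∑ i, density (fun x => ¬ P n i x)) atTop (𝓝 0) := by
    simpa using tendsto_finsetSum Finset.univ fun i _ => tendsto_density_not _ (h i)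
  refine squeeze_zero (fun _ => density_nonneg _) (fun n => ?_) h0
  simp only [not_forall]
  exact density_exists_le _

end Density

/-! ### Invertible matrices over large finite fields -/

theorem density_isUnit_matrix (F : Type*) [Field F] [Finite F] (t : ℕ) :
    density (fun T : Matrix (Fin t) (Fin t) F => IsUnit T) =
      ∏ i : Fin t, (1 - ((Nat.card F : ℝ) ^ (t - (i : ℕ)))⁻¹) := by
  have := Fintype.ofFinite F
  have hq : (Fintype.card F : ℝ) ≠ 0 := by exact_mod_cast Fintype.card_ne_zero
  have h1 : Nat.card {T : Matrix (Fin t) (Fin t) F // IsUnit T} =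
      ∏ i : Fin t, (Fintype.card F ^ t - Fintype.card F ^ (i : ℕ)) := by
    rw [← Matrix.card_GL_field]
    exact Nat.card_congr Submonoid.unitsTypeEquivIsUnitSubmonoid.symm.toEquiv
  have h2 : Nat.card (Matrix (Fin t) (Fin t) F) = ∏ _i : Fin t, Fintype.card F ^ t := by
    simp [Matrix]
  unfold density
  rw [h1, h2, Nat.cast_prod, Nat.cast_prod, ← Finset.prod_div_distrib]
  refine Finset.prod_congr rfl fun i _ => ?_
  rw [Nat.cast_sub (Nat.pow_le_pow_right Fintype.card_pos i.2.le), Nat.card_eq_fintype_card]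
  push_cast
  rw [sub_div, div_self (pow_ne_zero _ hq), pow_sub₀ _ hq i.2.le]
  field_simp

theorem tendsto_card_galoisField (p : ℕ) [hp : Fact p.Prime] :
    Tendsto (fun n => (Nat.card (GaloisField p n) : ℝ)) atTop atTop := by
  have h : Tendsto (fun n : ℕ => (p : ℝ) ^ n) atTop atTop :=
    tendsto_pow_atTop_atTop_of_one_lt (by exact_mod_cast hp.out.one_lt)
  refine h.congr' ?_
  filter_upwards [eventually_ne_atTop 0] with n hn
  rw [GaloisField.card p n hn]
  push_cast; rfl

theorem tendsto_density_isUnit_matrix (p : ℕ) [Fact p.Prime] (t : ℕ) :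
    Tendsto (fun n => density (fun T : Matrix (Fin t) (Fin t) (GaloisField p n) => IsUnit T))
      atTop (𝓝 1) := by
  simp only [density_isUnit_matrix]
  have : ∀ i : Fin t, Tendsto (fun n => 1 - ((Nat.card (GaloisField p n) : ℝ) ^ (t - (i : ℕ)))⁻¹)
      atTop (𝓝 1) := fun i => by
    have h := ((tendsto_pow_atTop (Nat.sub_ne_zero_of_lt i.2)).comp
      (tendsto_card_galoisField p)).inv_tendsto_atTop
    simpa using h.const_sub 1
  simpa using tendsto_finsetProd Finset.univ fun i _ => this i

/-! ### The matrix of an instance and its submatrices -/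

section Columns

variable {F : Type} {K d : ℕ} {m m' : Fin K → ℕ}

/-- Indices of the columns of all the coefficient matrices of an instance. -/
abbrev Col {K : ℕ} (m m' : Fin K → ℕ) : Type := Σ k : Fin K, Fin (m k) ⊕ Fin (m' k)

/-- An instance is the same as one matrix that holds all the columns. -/
def Instance.equivMatrix : Instance F K d m m' ≃ Matrix (Fin d) (Col m m') F where
  toFun Λ := fun i c => Sum.elim (Λ.v c.1 i) (Λ.v' c.1 i) c.2
  invFun M := ⟨fun k i a => M i ⟨k, .inl a⟩, fun k i b => M i ⟨k, .inr b⟩⟩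
  left_inv _ := rfl
  right_inv M := by ext i ⟨k, a | b⟩ <;> rfl

theorem density_submatrix {α β γ δ : Type*} [Finite α] [Finite β] [Finite F] [AddCommGroup F]
    {f : γ → α} {g : δ → β} (hf : Function.Injective f) (hg : Function.Injective g)
    (P : Matrix γ δ F → Prop) :
    density (fun M : Matrix α β F => P (M.submatrix f g)) = density P := by
  have : Finite (Matrix α β F) := inferInstanceAs (Finite (α → β → F))
  let φ : Matrix α β F →+ Matrix γ δ F :=
    { toFun := fun M => M.submatrix f g
      map_zero' := rfl
      map_add' := fun _ _ => rfl }
  refine density_comp_of_surjective φ (fun N => ?_) P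
  obtain ⟨M, hM⟩ := (hf.prodMap hg).surjective_comp_right (γ := F) (fun x => N x.1 x.2)
  exact ⟨fun a b => M (a, b), funext fun i => funext fun j => congrFun hM (i, j)⟩

theorem density_instance_submatrix {γ δ : Type*} [Finite F] [AddCommGroup F]
    {f : γ → Fin d} {g : δ → Col m m'} (hf : Function.Injective f) (hg : Function.Injective g)
    (P : Matrix γ δ F → Prop) :
    density (fun Λ : Instance F K d m m' => P (Λ.equivMatrix.submatrix f g)) = density P :=
  (density_comp_equiv Instance.equivMatrix fun M => P (M.submatrix f g)).trans
    (density_submatrix hf hg P)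

/-- The instance that keeps only the first columns of the coefficient matrices. -/
def Instance.restrict {l l' : Fin K → ℕ} (Λ : Instance F K d m m') (h : ∀ k, l k ≤ m k)
    (h' : ∀ k, l' k ≤ m' k) : Instance F K d l l' :=
  ⟨fun k => (Λ.v k).submatrix id (Fin.castLE (h k)),
    fun k => (Λ.v' k).submatrix id (Fin.castLE (h' k))⟩

theorem density_restrict [Finite F] [AddCommGroup F] {l l' : Fin K → ℕ} (h : ∀ k, l k ≤ m k)
    (h' : ∀ k, l' k ≤ m' k) (P : Instance F K d l l' → Prop) :
    density (fun Λ : Instance F K d m m' => P (Λ.restrict h h')) = density P := by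
  let g : Col l l' → Col m m' := Sigma.map id fun k => Sum.map (Fin.castLE (h k)) (Fin.castLE (h' k))
  have hg : Function.Injective g := Function.injective_id.sigma_map fun k =>
    (Fin.castLE_injective _).sumMap (Fin.castLE_injective _)
  rw [← density_comp_equiv Instance.equivMatrix.symm P,
    ← density_instance_submatrix (m := m) (m' := m') Function.injective_id hg]
  rfl

end Columns

theorem tendsto_density_isUnit_submatrix (p : ℕ) [Fact p.Prime] {K d t : ℕ} {m m' : Fin K → ℕ}
    {f : Fin t → Fin d} {g : Fin t → Col m m'} (hf : Function.Injective f)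
    (hg : Function.Injective g) :
    Tendsto (fun n => density (fun Λ : Instance (GaloisField p n) K d m m' =>
      IsUnit (Λ.equivMatrix.submatrix f g))) atTop (𝓝 1) := by
  refine (tendsto_density_isUnit_matrix p t).congr fun n => ?_
  exact (density_instance_submatrix hf hg _).symm

/-! ### The lower bound -/

section Lower

variable {F : Type} [Field F] [Finite F] {K d : ℕ} {m m' : Fin K → ℕ}

/-- Data supported on the rows `f` can be recovered from the broadcast and the side-information of
`𝒦` alone: these give all columns indexed by `g`, and the square submatrix is inverted. The bound is
the logarithm of the resulting injection of finite sets. -/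
theorem Scheme.IsAchievable.le_cost {Λ : Instance F K d m m'} {s : Scheme F K d m m'}
    (hs : s.IsAchievable Λ) (𝒦 : Finset (Fin K)) {t : ℕ} (f : Fin t → Fin d)
    (g : Fin t → Col m m') (hg : ∀ j, (g j).1 ∈ 𝒦)
    (hu : IsUnit (Λ.equivMatrix.submatrix f g)) :
    (t : ℝ) - ∑ k ∈ 𝒦, (m' k : ℝ) ≤ s.cost := by
  have := s.finite_alphabet
  have : Nonempty s.alphabet := ⟨s.encode 0⟩
  let B : Matrix (Fin t) (Fin d) F := (1 : Matrix (Fin d) (Fin d) F).submatrix f id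
  let x : Matrix (Fin s.L) (Fin t) F → Matrix (Fin d) (Fin s.L) F := fun y => (y * B).transpose
  have hx : ∀ y, ((x y).transpose * Λ.equivMatrix).submatrix id g =
      y * Λ.equivMatrix.submatrix f g := fun y => by
    have : B * Λ.equivMatrix.submatrix id g = Λ.equivMatrix.submatrix f g := by
      ext i j
      simp [B, Matrix.mul_apply, Matrix.one_apply]
    rw [← this, ← Matrix.mul_assoc]
    rfl
  let ψ : Matrix (Fin s.L) (Fin t) F →
      s.alphabet × ((k : 𝒦) → Matrix (Fin s.L) (Fin (m' k)) F) :=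
    fun y => (s.encode (x y), fun k => (x y).transpose * Λ.v' k)
  have hψ : Function.Injective ψ := fun y z hyz => by
    have h1 : s.encode (x y) = s.encode (x z) := congrArg Prod.fst hyz
    have h2 : ∀ k ∈ 𝒦, (x y).transpose * Λ.v' k = (x z).transpose * Λ.v' k := fun k hk =>
      congrFun (congrArg Prod.snd hyz) ⟨k, hk⟩
    have h3 : ∀ k ∈ 𝒦, (x y).transpose * Λ.v k = (x z).transpose * Λ.v k := fun k hk => by
      rw [← hs (x y) k, ← hs (x z) k, h1, h2 k hk]
    have hT := (Matrix.isUnit_iff_isUnit_det _).1 hu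
    rw [← Matrix.mul_nonsing_inv_cancel_right _ y hT, ← Matrix.mul_nonsing_inv_cancel_right _ z hT,
      ← hx, ← hx]
    congr 1
    ext l j
    have hj := hg j
    change ((x y).transpose * Λ.equivMatrix) l (g j) = ((x z).transpose * Λ.equivMatrix) l (g j)
    revert hj
    obtain ⟨k, a | b⟩ := g j <;> intro hj
    · exact congrFun (congrFun (h3 k hj) l) a
    · exact congrFun (congrFun (h2 k hj) l) b
  have hcard := Nat.card_le_card_of_injective ψ hψ
  have hq : 1 < (Nat.card F : ℝ) := by exact_mod_cast Finite.one_lt_card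
  have hL : (0 : ℝ) < s.L := by exact_mod_cast s.L_pos
  have hS : (0 : ℝ) < Nat.card s.alphabet := by exact_mod_cast Nat.card_pos
  have h1 : Nat.card (Matrix (Fin s.L) (Fin t) F) = Nat.card F ^ (t * s.L) := by
    simp [Matrix, Nat.card_fun, pow_mul]
  have h2 : Nat.card ((k : 𝒦) → Matrix (Fin s.L) (Fin (m' k)) F) =
      Nat.card F ^ ((∑ k ∈ 𝒦, m' k) * s.L) := by
    rw [Nat.card_pi, Finset.sum_mul, ← Finset.prod_pow_eq_pow_sum]
    simp only [Matrix, Nat.card_fun, Nat.card_fin, pow_mul]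
    exact Finset.prod_coe_sort 𝒦 fun k => (Nat.card F ^ m' k) ^ s.L
  rw [Nat.card_prod, h1, h2] at hcard
  have hlog := Real.logb_le_logb_of_le hq (by positivity)
    (show ((Nat.card F : ℝ) ^ (t * s.L)) ≤ Nat.card s.alphabet *
      (Nat.card F : ℝ) ^ ((∑ k ∈ 𝒦, m' k) * s.L) by exact_mod_cast hcard)
  rw [Real.logb_mul hS.ne' (by positivity), Real.logb_pow, Real.logb_pow,
    Real.logb_self_eq_one hq] at hlog
  push_cast at hlog
  rw [Scheme.cost, le_div_iff₀ hL]
  linarith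

end Lower

theorem exists_injective_col {K : ℕ} (m m' : Fin K → ℕ) (𝒦 : Finset (Fin K)) {t : ℕ}
    (ht : t ≤ ∑ k ∈ 𝒦, (m k + m' k)) :
    ∃ g : Fin t → Col m m', Function.Injective g ∧ ∀ j, (g j).1 ∈ 𝒦 := by
  have hc : Fintype.card (Fin t) ≤ Fintype.card (Σ k : 𝒦, Fin (m k) ⊕ Fin (m' k)) := by
    simp only [Fintype.card_fin, Fintype.card_sigma, Fintype.card_sum]
    rwa [Finset.sum_coe_sort 𝒦 fun k => m k + m' k]
  obtain ⟨e⟩ := Function.Embedding.nonempty_of_card_le hc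
  exact ⟨fun j => Sigma.map Subtype.val (fun _ => id) (e j),
    (Subtype.val_injective.sigma_map fun _ => Function.injective_id).comp e.injective,
    fun j => (e j).1.2⟩

theorem le_lowerCost (p : ℕ) [Fact p.Prime] (K d : ℕ) (m m' : Fin K → ℕ)
    (𝒦 : Finset (Fin K)) :
    min ((d : ℝ) - ∑ k ∈ 𝒦, (m' k : ℝ)) (∑ k ∈ 𝒦, (m k : ℝ)) ≤ lowerCost p K d m m' := by
  let t : ℕ := min d (∑ k ∈ 𝒦, (m k + m' k))
  obtain ⟨g, hg, hg𝒦⟩ := exists_injective_col m m' 𝒦 (min_le_right d _ : t ≤ _)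
  have ht : min ((d : ℝ) - ∑ k ∈ 𝒦, (m' k : ℝ)) (∑ k ∈ 𝒦, (m k : ℝ)) =
      (t : ℝ) - ∑ k ∈ 𝒦, (m' k : ℝ) := by
    simp only [t, Nat.cast_min, Nat.cast_sum, Nat.cast_add, Finset.sum_add_distrib]
    rw [← min_sub_sub_right, add_sub_cancel_right]
  -- `AasGt` asks for a strict inequality while the counting bound is not strict, so the bound is
  -- approached from below.
  refine le_of_forall_lt fun Δ hΔ => ?_
  obtain ⟨Δ', h1, h2⟩ := exists_between hΔ
  refine h1.trans_le (le_csSup (aasGt_bddAbove p K d m m') ?_)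
  refine tendsto_density_mono
    (tendsto_density_isUnit_submatrix p (Fin.castLE_injective (min_le_left d _ : t ≤ d)) hg)
    (Eventually.of_forall fun n Λ hΛ => h2.trans_le ?_)
  rw [ht]
  refine le_csInf ⟨_, dim_mem_costs Λ⟩ ?_
  rintro _ ⟨s, hs, rfl⟩
  exact hs.le_cost 𝒦 _ g hg𝒦 hΛ

/-! ### Monotonicity of the cost -/

/-- The encoder for `Γ` is kept: each user ignores its surplus side-information and selects its
columns from the decoded demand. -/
theorem optimalCost_le_optimalCost {F : Type} [Field F] [Finite F] {K d : ℕ}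
    {m m' l l' : Fin K → ℕ} (Λ : Instance F K d m m') (Γ : Instance F K d l l')
    (f : ∀ k, Fin (m k) → Fin (l k)) (f' : ∀ k, Fin (l' k) → Fin (m' k))
    (h : ∀ k, Λ.v k = (Γ.v k).submatrix id (f k))
    (h' : ∀ k, Γ.v' k = (Λ.v' k).submatrix id (f' k)) :
    optimalCost Λ ≤ optimalCost Γ := by
  refine le_csInf ⟨_, dim_mem_costs Γ⟩ ?_
  rintro _ ⟨s, hs, rfl⟩
  refine csInf_le (costs_bddBelow Λ) ⟨⟨s.L, s.L_pos, s.alphabet, s.finite_alphabet, s.encode,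
    fun k a y => (s.decode k a (y.submatrix id (f' k))).submatrix id (f k)⟩, fun x k => ?_, rfl⟩
  have := hs x k
  rw [h' k] at this
  rw [h k]
  exact congrArg (fun M => M.submatrix id (f k)) this

/-- Fewer demands and more side-information do not increase the cost. -/
theorem AasLe.mono {p : ℕ} [Fact p.Prime] {K d : ℕ} {m m' l l' : Fin K → ℕ} {Δ : ℝ}
    (h : AasLe p K d l l' Δ) (hl : ∀ k, m k ≤ l k) (hl' : ∀ k, l' k ≤ m' k) :
    AasLe p K d m m' Δ := by
  -- Coupling: both instances are obtained by restriction from one uniform instance with the larger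
  -- demands `l` and the larger side-information `m'`.
  have e1 : ∀ n, prob p n K d m m' (fun Λ => optimalCost Λ ≤ Δ) =
      density (fun Λ : Instance (GaloisField p n) K d l m' =>
        optimalCost (Λ.restrict hl (fun k => le_refl (m' k))) ≤ Δ) := fun n =>
    (density_restrict hl _ fun Λ => optimalCost Λ ≤ Δ).symm
  have e2 : ∀ n, prob p n K d l l' (fun Λ => optimalCost Λ ≤ Δ) =
      density (fun Λ : Instance (GaloisField p n) K d l m' =>
        optimalCost (Λ.restrict (fun k => le_refl (l k)) hl') ≤ Δ) := fun n =>
    (density_restrict _ hl' fun Λ => optimalCost Λ ≤ Δ).symm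
  unfold AasLe at h ⊢
  simp only [e1]
  simp only [e2] at h
  refine tendsto_density_mono h (Eventually.of_forall fun n Λ hΛ => le_trans ?_ hΛ)
  exact optimalCost_le_optimalCost _ _ (fun k => Fin.castLE (hl k)) (fun k => Fin.castLE (hl' k))
    (fun _ => rfl) (fun _ => rfl)

theorem AasLe.upperCost_le {p : ℕ} [Fact p.Prime] {K d : ℕ} {m m' : Fin K → ℕ} {Δ : ℝ}
    (h : AasLe p K d m m' Δ) : upperCost p K d m m' ≤ Δ :=
  csInf_le (aasLe_bddBelow p K d m m') h

/-! ### Additive schemes -/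

section Additive

variable {F : Type} [Field F] [Finite F] {K d : ℕ} {m m' : Fin K → ℕ}

/-- An additive encoder `Φ` is decodable as soon as the demand vanishes whenever both the broadcast
and the side-information vanish. -/
theorem optimalCost_le_of_additive (Λ : Instance F K d m m') {S : Type} [AddCommGroup S]
    [Finite S] (Φ : (Fin d → F) →+ S)
    (h : ∀ k x, Φ x = 0 → Matrix.vecMul x (Λ.v' k) = 0 → Matrix.vecMul x (Λ.v k) = 0) :
    optimalCost Λ ≤ Real.logb (Nat.card F) (Nat.card S) := by
  classical
  let enc : Matrix (Fin d) (Fin 1) F → S := fun X => Φ fun i => X i 0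
  -- With `L = 1`, the decoder picks any data consistent with what it observes; the value `0` is
  -- never used on actual transmissions. Additivity reduces correctness to the difference of two
  -- consistent data vectors.
  let s : Scheme F K d m m' := ⟨1, one_pos, S, inferInstance, enc, fun k a Y =>
    if H : ∃ X : Matrix (Fin d) (Fin 1) F, enc X = a ∧ X.transpose * Λ.v' k = Y
      then H.choose.transpose * Λ.v k else 0⟩
  have hs : s.IsAchievable Λ := fun X k => by
    have H : ∃ Z : Matrix (Fin d) (Fin 1) F, enc Z = enc X ∧
        Z.transpose * Λ.v' k = X.transpose * Λ.v' k := ⟨X, rfl, rfl⟩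
    have hdec : s.decode k (s.encode X) (X.transpose * Λ.v' k) = H.choose.transpose * Λ.v k :=
      dif_pos H
    rw [hdec]
    obtain ⟨h1, h2⟩ := H.choose_spec
    set Z := H.choose
    have h3 := h k (fun i => Z i 0 - X i 0) (by
      have : Φ ((fun i => Z i 0) - fun i => X i 0) = 0 := by
        rw [map_sub]; exact sub_eq_zero.2 h1
      exact this) (by
      have : Matrix.vecMul ((fun i => Z i 0) - fun i => X i 0) (Λ.v' k) = 0 := by
        rw [Matrix.sub_vecMul, sub_eq_zero]
        exact congrFun h2 0
      exact this)
    have h4 : Matrix.vecMul ((fun i => Z i 0) - fun i => X i 0) (Λ.v k) = 0 := h3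
    rw [Matrix.sub_vecMul, sub_eq_zero] at h4
    ext l j
    rw [Subsingleton.elim l 0]
    exact congrFun h4 j
  refine csInf_le (costs_bddBelow Λ) ⟨s, hs, ?_⟩
  simp [Scheme.cost, s]

theorem optimalCost_le_sum (Λ : Instance F K d m m') : optimalCost Λ ≤ ∑ k, (m k : ℝ) := by
  have hq : 1 < (Nat.card F : ℝ) := by exact_mod_cast Finite.one_lt_card
  let Φ : (Fin d → F) →+ ((k : Fin K) → Fin (m k) → F) :=
    { toFun := fun x k => Matrix.vecMul x (Λ.v k)
      map_zero' := by ext; simp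
      map_add' := fun x y => by ext; simp [Matrix.add_vecMul] }
  refine (optimalCost_le_of_additive Λ Φ fun k x hx _ => congrFun hx k).trans_eq ?_
  have : Nat.card ((k : Fin K) → Fin (m k) → F) = Nat.card F ^ ∑ k, m k := by
    rw [Nat.card_pi, ← Finset.prod_pow_eq_pow_sum]
    exact Finset.prod_congr rfl fun k _ => by rw [Nat.card_fun, Nat.card_fin]
  rw [this, Nat.cast_pow, Real.logb_pow, Real.logb_self_eq_one hq]
  simp

/-- If `t` rows of every side-information matrix contain an invertible `t × t` submatrix, then it
suffices to broadcast the other `d - t` data symbols. -/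
theorem optimalCost_le_sub (Λ : Instance F K d m m') {t : ℕ} {f : Fin t → Fin d}
    (hf : Function.Injective f) (g : ∀ k, Fin t → Fin (m' k))
    (hu : ∀ k, IsUnit ((Λ.v' k).submatrix f (g k))) : optimalCost Λ ≤ (d : ℝ) - t := by
  classical
  have hq : 1 < (Nat.card F : ℝ) := by exact_mod_cast Finite.one_lt_card
  let Φ : (Fin d → F) →+ ({i // i ∉ Set.range f} → F) :=
    { toFun := fun x i => x i
      map_zero' := rfl
      map_add' := fun x y => rfl }
  have key : ∀ k x, Φ x = 0 → Matrix.vecMul x (Λ.v' k) = 0 → Matrix.vecMul x (Λ.v k) = 0 := by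
    intro k x hx hx'
    have h0 : ∀ i, i ∉ Set.range f → x i = 0 := fun i hi => congrFun hx ⟨i, hi⟩
    have h1 : Matrix.vecMul (x ∘ f) ((Λ.v' k).submatrix f (g k)) = 0 := by
      ext j
      rw [Pi.zero_apply, ← show Matrix.vecMul x (Λ.v' k) (g k j) = 0 from congrFun hx' (g k j)]
      change ∑ i, x (f i) * Λ.v' k (f i) (g k j) = ∑ i, x i * Λ.v' k i (g k j)
      refine Finset.sum_of_injOn f hf.injOn (fun _ _ => Finset.mem_coe.2 (Finset.mem_univ _))
        (fun i _ hi => ?_) (fun i _ => rfl)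
      rw [h0 i (by simpa using hi), zero_mul]
    have h2 : x ∘ f = 0 := Matrix.vecMul_injective_of_isUnit (hu k) (by simpa using h1)
    have h3 : x = 0 := by
      ext i
      by_cases hi : i ∈ Set.range f
      · obtain ⟨j, rfl⟩ := hi
        exact congrFun h2 j
      · exact h0 i hi
    rw [h3, Matrix.zero_vecMul]
  have ht : t ≤ d := by simpa using Fintype.card_le_of_injective f hf
  refine (optimalCost_le_of_additive Λ Φ key).trans_eq ?_
  have : Nat.card ({i // i ∉ Set.range f} → F) = Nat.card F ^ (d - t) := by
    rw [Nat.card_fun]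
    congr 1
    rw [Nat.card_eq_fintype_card, Fintype.card_subtype_compl, Set.card_range_of_injective hf]
    simp
  rw [this, Nat.cast_pow, Real.logb_pow, Real.logb_self_eq_one hq, Nat.cast_sub ht, mul_one]

end Additive

theorem aasLe_sum (p : ℕ) [Fact p.Prime] (K d : ℕ) (m m' : Fin K → ℕ) :
    AasLe p K d m m' (∑ k, (m k : ℝ)) := by
  simp [AasLe, prob_of_forall, optimalCost_le_sum]

theorem aasLe_sub (p : ℕ) [Fact p.Prime] (K d : ℕ) (m m' : Fin K → ℕ) {t : ℕ} (ht : t ≤ d)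
    (ht' : ∀ k, t ≤ m' k) : AasLe p K d m m' ((d : ℝ) - t) := by
  have hg : ∀ k, Function.Injective (fun j : Fin t => (⟨k, .inr (Fin.castLE (ht' k) j)⟩ : Col m m')) :=
    fun k i j hij => by simpa using hij
  have h := tendsto_density_forall _ fun k =>
    tendsto_density_isUnit_submatrix p (Fin.castLE_injective ht) (hg k)
  refine tendsto_density_mono h (Eventually.of_forall fun n Λ hΛ => ?_)
  exact optimalCost_le_sub Λ (Fin.castLE_injective ht) (fun k => Fin.castLE (ht' k)) hΛ

/-! ### Almost invariant subspaces of a field extension -/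

section AlmostInvariant

variable {k : Type} [Field k] {F : Type} [Field F] [Algebra k F]

/-- The span of the monomials in `h` with all exponents at most `N`. -/
def monomialSpan (k : Type) [Field k] {F : Type} [Field F] [Algebra k F] {τ : Type} [Fintype τ]
    (h : τ → F) (N : ℕ) : Submodule k F :=
  Submodule.span k (Set.range fun α : τ → Fin (N + 1) => ∏ t, h t ^ (α t : ℕ))

variable {τ : Type} [Fintype τ] (h : τ → F)

theorem one_mem_monomialSpan (N : ℕ) : (1 : F) ∈ monomialSpan k h N :=
  Submodule.subset_span ⟨fun _ => 0, by simp⟩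

theorem mul_mem_monomialSpan (N : ℕ) (t : τ) {w : F} (hw : w ∈ monomialSpan k h N) :
    h t * w ∈ monomialSpan k h (N + 1) := by
  classical
  induction hw using Submodule.span_induction with
  | mem x hx =>
    obtain ⟨α, rfl⟩ := hx
    refine Submodule.subset_span
      ⟨fun s => ⟨(α s : ℕ) + if s = t then 1 else 0, by have := (α s).2; split_ifs <;> omega⟩, ?_⟩
    simp only [pow_add, Finset.prod_mul_distrib]
    rw [mul_comm]
    simp
  | zero => simp
  | add x y _ _ hx hy => rw [mul_add]; exact add_mem hx hy
  | smul c x _ hx => rw [mul_smul_comm]; exact Submodule.smul_mem _ c hx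

theorem finrank_monomialSpan_le (N : ℕ) :
    Module.finrank k (monomialSpan k h N) ≤ (N + 1) ^ Fintype.card τ := by
  classical
  refine (finrank_range_le_card _).trans ?_
  simp

theorem exists_pow_lt_pow {ε : ℝ} (hε : 0 < ε) (T : ℕ) :
    ∃ N : ℕ, ((N : ℝ) + 1) ^ T < (1 + ε) ^ N := by
  have h1 := tendsto_pow_const_div_const_pow_of_one_lt T (show 1 < 1 + ε by linarith)
  have h2 := (h1.comp (tendsto_add_atTop_nat 1)).eventually
    (gt_mem_nhds (show (0 : ℝ) < (1 + ε)⁻¹ by positivity))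
  obtain ⟨N, hN⟩ := h2.exists
  refine ⟨N, ?_⟩
  simp only [Function.comp_apply, Nat.cast_add, Nat.cast_one] at hN
  rw [div_lt_iff₀ (by positivity), pow_succ] at hN
  calc _ < _ := hN
    _ = _ := by field_simp

/-- Polynomial growth: some span of monomials of bounded degree hardly grows in the next step. -/
theorem exists_finrank_monomialSpan_succ_le [FiniteDimensional k F] {ε : ℝ} {N : ℕ}
    (hε : 0 < ε) (hN : ((N : ℝ) + 1) ^ Fintype.card τ < (1 + ε) ^ N) :
    ∃ M < N, (Module.finrank k (monomialSpan k h (M + 1)) : ℝ) ≤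
      (1 + ε) * Module.finrank k (monomialSpan k h M) := by
  by_contra! H
  -- If every step grew by more than the factor `1 + ε`, the dimension would be exponential in `N`,
  -- against the number of monomials.
  have key : ∀ M ≤ N, (1 + ε) ^ M ≤ (Module.finrank k (monomialSpan k h M) : ℝ) := by
    intro M
    induction M with
    | zero =>
      intro _
      rw [pow_zero, Nat.one_le_cast, Nat.one_le_iff_ne_zero]
      intro h0
      have := (Submodule.finrank_eq_zero.1 h0) ▸ one_mem_monomialSpan (k := k) h 0
      exact one_ne_zero ((Submodule.mem_bot k).1 this)
    | succ M ih =>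
      intro hM
      have h1 := ih (by omega)
      have h2 := H M (by omega)
      rw [pow_succ']
      exact (mul_le_mul_of_nonneg_left h1 (by linarith)).trans h2.le
  have h1 := key N le_rfl
  have h2 : (Module.finrank k (monomialSpan k h N) : ℝ) ≤ ((N : ℝ) + 1) ^ Fintype.card τ := by
    exact_mod_cast finrank_monomialSpan_le (k := k) h N
  linarith

theorem finrank_map_mulLeft {β : F} (hβ : β ≠ 0) (B : Submodule k F) :
    Module.finrank k (B.map (LinearMap.mulLeft k β)) = Module.finrank k B :=
  (Submodule.equivMapOfInjective (LinearMap.mulLeft k β) (mul_right_injective₀ hβ) B).finrank_eq.symm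

variable [Finite k] [FiniteDimensional k F]

/-- A bad `β` is a quotient of an element of `W` by one of `B`, and there are fewer such pairs than
elements of `F`. -/
theorem exists_smul_disjoint (W B : Submodule k F)
    (hWB : Module.finrank k W + Module.finrank k B < Module.finrank k F) :
    ∃ β : F, β ≠ 0 ∧ Disjoint W (B.map (LinearMap.mulLeft k β)) := by
  have : Finite F := Module.finite_of_finite k
  by_cases hB : B = ⊥
  · exact ⟨1, one_ne_zero, by simp [hB]⟩
  have hk : 1 < Nat.card k := Finite.one_lt_card
  have hcard : Nat.card (W × B) < Nat.card F := by
    rw [Nat.card_prod, Module.natCard_eq_pow_finrank (K := k) (V := W),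
      Module.natCard_eq_pow_finrank (K := k) (V := B),
      Module.natCard_eq_pow_finrank (K := k) (V := F), ← pow_add]
    exact Nat.pow_lt_pow_right hk hWB
  have hns : ¬ Function.Surjective (fun x : W × B => (x.1 : F) / x.2) := fun hs =>
    (Nat.card_le_card_of_surjective _ hs).not_gt hcard
  simp only [Function.Surjective, not_forall, not_exists] at hns
  obtain ⟨β, hβ⟩ := hns
  have hβ0 : β ≠ 0 := by
    rintro rfl
    exact hβ (0, 0) (by simp)
  refine ⟨β, hβ0, Submodule.disjoint_def.2 ?_⟩
  rintro _ hw ⟨b, hb, rfl⟩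
  by_contra h0
  have hb0 : b ≠ 0 := by rintro rfl; simp at h0
  exact hβ (⟨_, hw⟩, ⟨b, hb⟩) (by simp [hb0])

/-- Translates `β B` by scalars are independent copies of `B`, and multiplication by `g t` commutes
with `β`, so it sends `β B` into `β B'`. The growth ratio is thus kept while the dimension is
multiplied by `s`. -/
theorem exists_multiple_copies {ι : Type} (g : ι → F) {B B' : Submodule k F}
    (hB : ∀ t, ∀ w ∈ B, g t * w ∈ B') (s : ℕ)
    (hs : s * Module.finrank k B < Module.finrank k F) :
    ∃ W U : Submodule k F, (∀ t, ∀ w ∈ W, g t * w ∈ U) ∧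
      Module.finrank k W = s * Module.finrank k B ∧
      Module.finrank k U ≤ s * Module.finrank k B' := by
  induction s with
  | zero => exact ⟨⊥, ⊥, by simp, by simp, by simp⟩
  | succ s ih =>
    rw [add_one_mul] at hs
    obtain ⟨W, U, hWU, hW, hU⟩ := ih (by omega)
    obtain ⟨β, hβ, hd⟩ := exists_smul_disjoint W B (by omega)
    refine ⟨W ⊔ B.map (LinearMap.mulLeft k β), U ⊔ B'.map (LinearMap.mulLeft k β),
      fun t w hw => ?_, ?_, ?_⟩
    · obtain ⟨x, hx, _, ⟨b, hb, rfl⟩, rfl⟩ := Submodule.mem_sup.1 hw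
      refine Submodule.mem_sup.2 ⟨_, hWU t x hx, _, ⟨g t * b, hB t b hb, rfl⟩, ?_⟩
      simp only [LinearMap.mulLeft_apply]
      ring
    · have := Submodule.finrank_sup_add_finrank_inf_eq W (B.map (LinearMap.mulLeft k β))
      rw [hd.eq_bot, finrank_bot, finrank_map_mulLeft hβ] at this
      rw [add_one_mul]
      omega
    · refine (Submodule.finrank_add_le_finrank_add_finrank _ _).trans ?_
      rw [finrank_map_mulLeft hβ, add_one_mul]
      omega

end AlmostInvariant

/-- In every extension of `k` of large degree, finitely many multiplications almost leave invariant
some subspace whose dimension is about `ρ` times the degree. -/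
theorem exists_almost_invariant (k : Type) [Field k] [Finite k] (τ : Type) [Fintype τ]
    {ε ρ : ℝ} (hε : 0 < ε) (hρ0 : 0 ≤ ρ) (hρ : ρ < 1) :
    ∃ n₀ : ℕ, ∀ (F : Type) [Field F] [Algebra k F] [FiniteDimensional k F],
      n₀ ≤ Module.finrank k F → ∀ h : τ → F, ∃ W U : Submodule k F,
        (∀ t, ∀ w ∈ W, h t * w ∈ U) ∧
        (Module.finrank k U : ℝ) ≤ (1 + ε) * Module.finrank k W ∧
        (ρ - ε) * Module.finrank k F ≤ Module.finrank k W ∧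
        (Module.finrank k W : ℝ) ≤ ρ * Module.finrank k F := by
  obtain ⟨N, hN⟩ := exists_pow_lt_pow hε (Fintype.card τ)
  -- The dimension `a` below is at most `(N + 1) ^ card τ` whatever `F` and `h` are. From this
  -- degree on it is at most `ε n`, so rounding `ρ n` down to a multiple of `a` loses at most `ε n`.
  refine ⟨max 1 ⌈((N : ℝ) + 1) ^ Fintype.card τ / ε⌉₊, fun F _ _ _ hn h => ?_⟩
  obtain ⟨M, hM, hgrow⟩ := exists_finrank_monomialSpan_succ_le (k := k) h hε hN
  set n := Module.finrank k F
  set a := Module.finrank k (monomialSpan k h M)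
  have hn1 : (0 : ℝ) < n := by exact_mod_cast (le_max_left _ _).trans hn
  have ha : (a : ℝ) ≤ ε * n := by
    have h1 : a ≤ (M + 1) ^ Fintype.card τ := finrank_monomialSpan_le h M
    have h2 : (a : ℝ) ≤ ((N : ℝ) + 1) ^ Fintype.card τ := by
      refine (Nat.cast_le.2 h1).trans ?_
      push_cast
      gcongr
    have h3 : ((N : ℝ) + 1) ^ Fintype.card τ / ε ≤ n :=
      (Nat.le_ceil _).trans (by exact_mod_cast (le_max_right _ _).trans hn)
    rw [div_le_iff₀ hε] at h3
    linarith
  have ha0 : 0 < a := by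
    rw [Nat.pos_iff_ne_zero]
    intro h0
    have := (Submodule.finrank_eq_zero.1 h0) ▸ one_mem_monomialSpan (k := k) h M
    exact one_ne_zero ((Submodule.mem_bot k).1 this)
  have ha0' : (0 : ℝ) < a := by exact_mod_cast ha0
  let s : ℕ := ⌊ρ * n / a⌋₊
  have hs : (s : ℝ) * a ≤ ρ * n := by
    rw [← le_div_iff₀ ha0']
    exact Nat.floor_le (by positivity)
  have hs' : ρ * n < (s + 1 : ℝ) * a := by
    rw [← div_lt_iff₀ ha0']
    exact Nat.lt_floor_add_one _
  have hsn : s * a < n := by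
    have : (s : ℝ) * a < n := hs.trans_lt (by nlinarith)
    exact_mod_cast this
  obtain ⟨W, U, hWU, hW, hU⟩ := exists_multiple_copies h
    (fun t w hw => mul_mem_monomialSpan h M t hw) s hsn
  refine ⟨W, U, hWU, ?_, ?_, ?_⟩
  · rw [hW]
    calc (Module.finrank k U : ℝ) ≤ s * Module.finrank k (monomialSpan k h (M + 1)) := by
          exact_mod_cast hU
      _ ≤ s * ((1 + ε) * a) := by gcongr
      _ = _ := by push_cast; ring
  · rw [hW]; push_cast
    linarith
  · rw [hW]; push_cast
    exact hs

/-! ### Schemes from almost invariant subspaces -/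

section Alignment

variable {F : Type} {K d m m' : ℕ} {Q : Type}

/-- An instance with equal dimensions for all users, cut into a square block and the remaining rows
for each user. -/
def Instance.equivBlocks (e : (Fin m ⊕ Fin m') ⊕ Q ≃ Fin d) :
    Instance F K d (fun _ => m) (fun _ => m') ≃
      (Fin K → Matrix (Fin m ⊕ Fin m') (Fin m ⊕ Fin m') F) ×
        (Fin K → Matrix Q (Fin m ⊕ Fin m') F) where
  toFun Λ := (fun k i => Sum.elim (Λ.v k (e (.inl i))) (Λ.v' k (e (.inl i))),
    fun k q => Sum.elim (Λ.v k (e (.inr q))) (Λ.v' k (e (.inr q))))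
  invFun P := ⟨fun k i a => Sum.elim (fun j => P.1 k j) (fun q => P.2 k q) (e.symm i) (.inl a),
    fun k i b => Sum.elim (fun j => P.1 k j) (fun q => P.2 k q) (e.symm i) (.inr b)⟩
  left_inv Λ := by
    ext k i a
    · obtain ⟨j, rfl⟩ := e.surjective i
      rcases j with j | q <;> simp
    · obtain ⟨j, rfl⟩ := e.surjective i
      rcases j with j | q <;> simp
  right_inv P := by
    ext k i c <;> rcases c with a | b <;> simp

variable [Field F] [Finite F] {κ : Type} [Field κ] [Algebra κ F]

/-- Any functional with `l 1 ≠ 0` works: test with `z = y⁻¹`. -/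
theorem exists_dual_mul_nondegenerate [FiniteDimensional κ F] :
    ∃ l : Module.Dual κ F, ∀ y, (∀ z, l (y * z) = 0) → y = 0 := by
  obtain ⟨l, hl⟩ : ∃ l : Module.Dual κ F, l 1 ≠ 0 := by
    by_contra! H
    exact one_ne_zero ((Module.forall_dual_apply_eq_zero_iff κ (1 : F)).1 H)
  refine ⟨l, fun y hy => ?_⟩
  by_contra h0
  exact hl (by simpa [h0] using hy y⁻¹)

/-- If the encoder reveals `l (u * x i)` for all `u` in `U`, where `U` contains the products of `W`
with the entries of the aligned matrices `V T⁻¹`, then each user learns all but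
`m [F : κ] - (m + m') dim W` dimensions of its demand. -/
theorem optimalCost_le_of_alignment [FiniteDimensional κ F] (e : (Fin m ⊕ Fin m') ⊕ Q ≃ Fin d)
    (Λ : Instance F K d (fun _ => m) (fun _ => m')) (W U : Submodule κ F) (hWU : W ≤ U)
    (hT : ∀ k, IsUnit ((Λ.equivBlocks e).1 k))
    (hB : ∀ k q j, ∀ w ∈ W, ((Λ.equivBlocks e).2 k * ((Λ.equivBlocks e).1 k)⁻¹) q j * w ∈ U)
    (hW : ∀ k (b : Fin m' → F),
      (∀ j, ((Λ.equivBlocks e).1 k).mulVec (Sum.elim 0 b) j ∈ W) → b = 0) :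
    optimalCost Λ ≤ (d * Module.finrank κ U + K * (m * Module.finrank κ F -
      (m + m') * Module.finrank κ W)) / Module.finrank κ F := by
  classical
  have : Finite κ := Finite.of_injective _ (algebraMap κ F).injective
  obtain ⟨l, hl⟩ := exists_dual_mul_nondegenerate (κ := κ) (F := F)
  set T := (Λ.equivBlocks e).1
  set B := (Λ.equivBlocks e).2
  have hdet : ∀ k, IsUnit (T k).det := fun k => (Matrix.isUnit_iff_isUnit_det _).1 (hT k)
  -- `θ k w` is the demand part of `T_k⁻¹ w`. If it vanishes, then `T_k` maps some `(0, b)` to `w`,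
  -- and `hW` forces `b = 0`; hence `θ k` is injective.
  let θ : Fin K → ((Fin m ⊕ Fin m') → W) →ₗ[κ] (Fin m → F) := fun k =>
    { toFun := fun w a => ((T k)⁻¹.mulVec fun j => (w j : F)) (.inl a)
      map_add' := fun w w' => by
        have : (fun j => ((w + w') j : F)) = (fun j => (w j : F)) + fun j => (w' j : F) := rfl
        ext a
        rw [this, Matrix.mulVec_add]
        rfl
      map_smul' := fun c w => by
        have : (fun j => ((c • w) j : F)) = c • fun j => (w j : F) := rfl
        ext a
        rw [this, Matrix.mulVec_smul]
        rfl }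
  have hθ : ∀ k, Function.Injective (θ k) := fun k => by
    rw [injective_iff_map_eq_zero]
    intro w hw
    set z := (T k)⁻¹.mulVec fun j => (w j : F) with hz
    have hz1 : z = Sum.elim (0 : Fin m → F) (fun b => z (.inr b)) := by
      ext (a | b)
      · exact congrFun hw a
      · rfl
    have hz2 : (T k).mulVec z = fun j => (w j : F) := by
      rw [hz, Matrix.mulVec_mulVec, Matrix.mul_nonsing_inv _ (hdet k), Matrix.one_mulVec]
    have hz3 : (fun b => z (.inr b)) = 0 := hW k _ fun j => by
      rw [← hz1, hz2]
      exact (w j).2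
    have hz4 : z = 0 := by
      rw [hz1, hz3]
      ext (a | b) <;> rfl
    rw [hz4, Matrix.mulVec_zero] at hz2
    ext j
    exact (congrFun hz2 j).symm
  -- The range of `θ k` consists of the directions learned from the aligned part; the encoder
  -- supplies the directions in the complement `C k` separately.
  choose C hC using fun k => Submodule.exists_isCompl (LinearMap.range (θ k))
  have hCrank : ∀ k, (Module.finrank κ (C k) : ℝ) =
      m * Module.finrank κ F - (m + m') * Module.finrank κ W := fun k => by
    have h1 := Submodule.finrank_add_eq_of_isCompl (hC k)
    rw [LinearMap.finrank_range_of_inj (hθ k), Module.finrank_pi_fintype,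
      Module.finrank_pi_fintype] at h1
    simp only [Finset.sum_const, Finset.card_univ, Fintype.card_sum, Fintype.card_fin,
      smul_eq_mul] at h1
    rw [eq_sub_iff_add_eq, add_comm]
    exact_mod_cast h1
  let Φ : (Fin d → F) →+ (Fin d → Module.Dual κ U) × ((k : Fin K) → Module.Dual κ (C k)) :=
    { toFun := fun x => (fun i => (l ∘ₗ LinearMap.mulLeft κ (x i)) ∘ₗ U.subtype,
        fun k => l ∘ₗ (∑ a, LinearMap.mulLeft κ (Matrix.vecMul x (Λ.v k) a) ∘ₗ
          LinearMap.proj a) ∘ₗ (C k).subtype)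
      map_zero' := by
        ext <;> simp
      map_add' := fun x y => by
        ext
        · simp [add_mul]
        · simp [add_mul, Matrix.add_vecMul, Finset.sum_add_distrib] }
  have key : ∀ k x, Φ x = 0 → Matrix.vecMul x (Λ.v' k) = 0 → Matrix.vecMul x (Λ.v k) = 0 := by
    intro k x hx hx'
    have h1 : ∀ i, ∀ u ∈ U, l (x i * u) = 0 := fun i u hu =>
      LinearMap.congr_fun (congrFun (congrArg Prod.fst hx) i) ⟨u, hu⟩
    set y := Matrix.vecMul x (Λ.v k) with hy
    have h2 : ∀ z ∈ C k, l (∑ a, y a * z a) = 0 := fun z hz => by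
      have := LinearMap.congr_fun (congrFun (congrArg Prod.snd hx) k) ⟨z, hz⟩
      simpa [Φ] using this
    have h3 : ∀ z ∈ LinearMap.range (θ k), l (∑ a, y a * z a) = 0 := by
      rintro _ ⟨w, rfl⟩
      -- All entries of `V T⁻¹ w` lie in `U`: rows of the square block give entries of `w`, the
      -- others are handled by `hB`. As `xᵀ V = (y, 0)`, pairing with `x` leaves only `y · θ k w`.
      let V : Matrix (Fin d) (Fin m ⊕ Fin m') F := Matrix.fromCols (Λ.v k) (Λ.v' k)
      have hV : ∀ i, ((V * (T k)⁻¹).mulVec fun j => (w j : F)) i ∈ U := by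
        intro i
        obtain ⟨j, rfl⟩ := e.surjective i
        rcases j with j | q
        · have : (V * (T k)⁻¹) (e (.inl j)) = (T k * (T k)⁻¹) j := rfl
          rw [Matrix.mulVec, this, Matrix.mul_nonsing_inv _ (hdet k)]
          have h4 : ((1 : Matrix _ _ F).mulVec fun j => (w j : F)) j = w j := by
            rw [Matrix.one_mulVec]
          exact (show (1 : Matrix _ _ F) j ⬝ᵥ (fun j => (w j : F)) = w j from h4) ▸ hWU (w j).2
        · exact (Submodule.sum_mem U fun j _ => hB k q j _ (w j).2 :
            ∑ j, (B k * (T k)⁻¹) q j * (w j : F) ∈ U)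
      have h5 : ∑ a, y a * θ k w a =
          ∑ i, x i * ((V * (T k)⁻¹).mulVec fun j => (w j : F)) i := by
        have h6 : Matrix.vecMul x V = Sum.elim y 0 := by
          rw [Matrix.vecMul_fromCols, hx']
        have h7 : x ⬝ᵥ ((V * (T k)⁻¹).mulVec fun j => (w j : F)) =
            Sum.elim y 0 ⬝ᵥ ((T k)⁻¹.mulVec fun j => (w j : F)) := by
          rw [← Matrix.mulVec_mulVec, Matrix.dotProduct_mulVec, h6]
        refine Eq.trans ?_ h7.symm
        simp only [dotProduct, Fintype.sum_sum_type, Sum.elim_inl, Sum.elim_inr, Pi.zero_apply,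
          zero_mul, Finset.sum_const_zero, add_zero]
        rfl
      rw [h5, map_sum]
      exact Finset.sum_eq_zero fun i _ => h1 i _ (hV i)
    have h4 : ∀ z : Fin m → F, l (∑ a, y a * z a) = 0 := fun z => by
      have hz : z ∈ LinearMap.range (θ k) ⊔ C k := (hC k).sup_eq_top ▸ Submodule.mem_top
      obtain ⟨z₁, hz₁, z₂, hz₂, rfl⟩ := Submodule.mem_sup.1 hz
      simp only [Pi.add_apply, mul_add, Finset.sum_add_distrib, map_add, h3 z₁ hz₁, h2 z₂ hz₂,
        add_zero]
    ext a
    refine hl (y a) fun c => ?_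
    simpa [Pi.single_apply] using h4 (Pi.single a c)
  have hfin : ∀ (V : Type) [AddCommGroup V] [Module κ V] [FiniteDimensional κ V],
      Nat.card (Module.Dual κ V) = Nat.card κ ^ Module.finrank κ V := fun V _ _ _ => by
    rw [Module.natCard_eq_pow_finrank (K := κ) (V := Module.Dual κ V), Subspace.dual_finrank_eq]
  have : ∀ (V : Submodule κ F), Finite (Module.Dual κ V) := fun V =>
    Module.finite_of_finite κ
  have : ∀ k, Finite (Module.Dual κ (C k)) := fun k => Module.finite_of_finite κ
  refine (optimalCost_le_of_additive Λ Φ key).trans_eq ?_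
  have hq : (1 : ℝ) < Nat.card κ := by exact_mod_cast Finite.one_lt_card
  have hlog : Real.log (Nat.card κ) ≠ 0 := (Real.log_pos hq).ne'
  rw [Nat.card_prod, Nat.card_fun, Nat.card_pi, Module.natCard_eq_pow_finrank (K := κ) (V := F),
    hfin, Finset.prod_congr rfl fun k _ => hfin (C k), Finset.prod_pow_eq_pow_sum, ← pow_mul,
    ← pow_add, Real.logb]
  push_cast
  rw [Real.log_pow, Real.log_pow, mul_div_mul_right _ _ hlog]
  push_cast
  rw [Finset.sum_congr rfl fun k _ => hCrank k]
  simp [mul_comm]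
  ring

end Alignment

/-! ### The proportion of instances that do not allow alignment -/

section Counting

variable {F : Type} [Field F] [Finite F] {K : ℕ} {R Q : Type} [Fintype R] [DecidableEq R]
  [Finite Q]

/-- On invertible `T`, the map `(T, B) ↦ (T, B T⁻¹)` is injective, so `B T⁻¹` may be treated as a
uniform matrix independent of `T`. -/
theorem density_isUnit_and_le
    (E : (Fin K → Matrix R R F) × (Fin K → Matrix Q R F) → Prop) :
    density (fun P : (Fin K → Matrix R R F) × (Fin K → Matrix Q R F) =>
      (∀ k, IsUnit (P.1 k)) ∧ E (P.1, fun k => P.2 k * (P.1 k)⁻¹)) ≤ density E := by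
  have : Finite (Matrix R R F) := inferInstanceAs (Finite (R → R → F))
  have : Finite (Matrix Q R F) := inferInstanceAs (Finite (Q → R → F))
  unfold density
  gcongr
  refine Nat.card_le_card_of_injective
    (fun P => ⟨(P.1.1, fun k => P.1.2 k * (P.1.1 k)⁻¹), P.2.2⟩) ?_
  rintro ⟨⟨T, B⟩, hT, _⟩ ⟨⟨T', B'⟩, hT', _⟩ h
  simp only [Subtype.mk.injEq, Prod.mk.injEq] at h
  obtain ⟨rfl, h⟩ := h
  simp only [Subtype.mk.injEq, Prod.mk.injEq, true_and]
  funext k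
  have hdet := (Matrix.isUnit_iff_isUnit_det _).1 (hT k)
  rw [← Matrix.nonsing_inv_mul_cancel_right _ (B k) hdet,
    ← Matrix.nonsing_inv_mul_cancel_right _ (B' k) hdet]
  exact congrArg (· * T k) (congrFun h k)

theorem density_mulVec_eq (k : Fin K) {c : R → F} (hc : c ≠ 0) (y : R → F) :
    density (fun T : Fin K → Matrix R R F => (T k).mulVec c = y) =
      ((Nat.card F : ℝ) ^ Fintype.card R)⁻¹ := by
  have : Finite (Matrix R R F) := inferInstanceAs (Finite (R → R → F))
  obtain ⟨j, hj⟩ := Function.ne_iff.1 hc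
  let φ : (Fin K → Matrix R R F) →+ (R → F) :=
    { toFun := fun T => (T k).mulVec c
      map_zero' := by simp
      map_add' := fun T T' => by simp [Matrix.add_mulVec] }
  have hφ : Function.Surjective φ := fun z => by
    -- A rank-one matrix sends `c` to `z`, using a nonzero coordinate of `c`.
    refine ⟨fun _ => Matrix.vecMulVec z (Pi.single j (c j)⁻¹), ?_⟩
    change (Matrix.vecMulVec z (Pi.single j (c j)⁻¹)).mulVec c = z
    ext i
    simp only [Matrix.mulVec, dotProduct, Matrix.vecMulVec_apply]
    rw [Finset.sum_eq_single j (fun b _ hb => by simp [hb]) (by simp)]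
    simp [show c j ≠ 0 from hj]
  refine (density_eq_of_surjective φ hφ y).trans ?_
  rw [Nat.card_fun, Nat.card_eq_fintype_card (α := R)]
  push_cast
  rfl

/-- Union bound over the user, the nonzero vector `b` and the target in `W^(m+m')`; each single
equation has probability `q^(-(m+m'))`. -/
theorem density_exists_mulVec_mem_le {m m' : ℕ} (W : Set F) :
    density (fun T : Fin K → Matrix (Fin m ⊕ Fin m') (Fin m ⊕ Fin m') F =>
      ∃ k, ∃ b : Fin m' → F, b ≠ 0 ∧ ∀ j, (T k).mulVec (Sum.elim 0 b) j ∈ W) ≤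
      K * (Nat.card W : ℝ) ^ (m + m') / (Nat.card F : ℝ) ^ m := by
  classical
  have := Fintype.ofFinite F
  have := Fintype.ofFinite W
  have hq : (0 : ℝ) < Nat.card F := by exact_mod_cast Nat.card_pos
  let ι := Fin K × {b : Fin m' → F // b ≠ 0} × ((Fin m ⊕ Fin m') → W)
  calc _ ≤ density (fun T : Fin K → Matrix (Fin m ⊕ Fin m') (Fin m ⊕ Fin m') F =>
        ∃ i : ι, (T i.1).mulVec (Sum.elim 0 i.2.1.1) = fun j => (i.2.2 j : F)) :=
        density_mono fun T ⟨k, b, hb, h⟩ => ⟨(k, ⟨b, hb⟩, fun j => ⟨_, h j⟩), rfl⟩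
    _ ≤ ∑ i : ι, density (fun T : Fin K → Matrix (Fin m ⊕ Fin m') (Fin m ⊕ Fin m') F =>
        (T i.1).mulVec (Sum.elim 0 i.2.1.1) = fun j => (i.2.2 j : F)) := density_exists_le _
    _ = ∑ _i : ι, ((Nat.card F : ℝ) ^ (m + m'))⁻¹ := by
        refine Finset.sum_congr rfl fun i _ => ?_
        rw [density_mulVec_eq i.1 (fun h => i.2.1.2 (funext fun b => congrFun h (.inr b)))]
        simp
    _ = Fintype.card ι * ((Nat.card F : ℝ) ^ (m + m'))⁻¹ := by simp
    _ ≤ (K * ((Nat.card F : ℝ) ^ m' * (Nat.card W : ℝ) ^ (m + m'))) *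
          ((Nat.card F : ℝ) ^ (m + m'))⁻¹ := by
        gcongr
        have h1 : Fintype.card {b : Fin m' → F // b ≠ 0} ≤ Nat.card F ^ m' := by
          refine (Fintype.card_subtype_le _).trans ?_
          simp
        have h2 : Fintype.card ι = K * (Fintype.card {b : Fin m' → F // b ≠ 0} *
            Nat.card W ^ (m + m')) := by
          simp [ι]
        rw [h2]
        push_cast
        gcongr
        exact_mod_cast h1
    _ = _ := by
        rw [pow_add (Nat.card F : ℝ) m m']
        field_simp

end Counting

theorem tendsto_alignment_failure (p : ℕ) [hp : Fact p.Prime] (K : ℕ) {ε : ℝ} (hε : 0 < ε) :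
    Tendsto (fun n : ℕ => (K : ℝ) * ((p : ℝ) ^ (-ε)) ^ n) atTop (𝓝 0) := by
  have hp1 : (1 : ℝ) < p := by exact_mod_cast hp.out.one_lt
  have h := tendsto_pow_atTop_nhds_zero_of_lt_one (Real.rpow_nonneg (zero_le_one.trans hp1.le) (-ε))
    (Real.rpow_lt_one_of_one_lt_of_neg hp1 (neg_lt_zero.2 hε))
  simpa using h.const_mul (K : ℝ)

theorem tendsto_density_isUnit_equivBlocks (p : ℕ) [Fact p.Prime] (K : ℕ) {d m m' : ℕ} {Q : Type}
    (e : (Fin m ⊕ Fin m') ⊕ Q ≃ Fin d) :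
    Tendsto (fun n => density (fun Λ :
      Instance (GaloisField p n) K d (fun _ => m) (fun _ => m') =>
        ∀ k, IsUnit ((Λ.equivBlocks e).1 k))) atTop (𝓝 1) := by
  have hg : ∀ k : Fin K, Function.Injective (fun j : Fin (m + m') =>
      (⟨k, finSumFinEquiv.symm j⟩ : Col (fun _ : Fin K => m) (fun _ => m'))) := fun k i j hij => by
    simpa using hij
  have hf : Function.Injective fun i : Fin (m + m') => e (.inl (finSumFinEquiv.symm i)) :=
    e.injective.comp (Sum.inl_injective.comp finSumFinEquiv.symm.injective)
  have h := tendsto_density_forall _ fun k => tendsto_density_isUnit_submatrix p hf (hg k)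
  refine tendsto_density_mono h (Eventually.of_forall fun n Λ hΛ k => ?_)
  rw [Matrix.isUnit_iff_isUnit_det,
    ← Matrix.det_submatrix_equiv_self (finSumFinEquiv (m := m) (n := m')).symm]
  exact (Matrix.isUnit_iff_isUnit_det _).1 (hΛ k)

/-- With `r = m + m'`, the excess over `m d / r` is at most `d ε` from the revealed space `U` and `2
K r ε` from the supplements. -/
theorem alignment_cost_le {d K m n r w u ε δ : ℝ} (hd0 : 0 ≤ d) (hK0 : 0 ≤ K) (hε : 0 < ε)
    (hr0 : 0 < r) (hmr : m / r ≤ 1) (hn : 0 < n) (hδ : (d + 2 * K * r + 1) * ε ≤ δ)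
    (hu : u ≤ (1 + ε) * w) (hwl : (m / r - ε - ε) * n ≤ w) (hwu : w ≤ (m / r - ε) * n) :
    (d * u + K * (m * n - r * w)) / n ≤ m * d / r + δ := by
  rw [div_le_iff₀ hn]
  have h4 : u ≤ (m / r + ε) * n := by
    refine hu.trans ((mul_le_mul_of_nonneg_left hwu (by linarith)).trans ?_)
    rw [← mul_assoc]
    refine mul_le_mul_of_nonneg_right ?_ hn.le
    nlinarith
  have h5 : m * n - r * w ≤ 2 * r * ε * n := by
    have h6 := mul_le_mul_of_nonneg_left hwl hr0.le
    have h7 : r * ((m / r - ε - ε) * n) = m * n - 2 * r * ε * n := by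
      field_simp
      ring
    linarith
  calc d * u + K * (m * n - r * w)
      ≤ d * ((m / r + ε) * n) + K * (2 * r * ε * n) := by gcongr
    _ = (m * d / r + (d + 2 * K * r) * ε) * n := by ring
    _ ≤ (m * d / r + δ) * n := by
      gcongr
      linarith

/-- The bound for the proportion of failures from the counting of pairs, for a subspace of
`F` of size `c ^ w`, where `F` has size `c ^ n`. -/
theorem alignment_failure_le {c ε : ℝ} {K m m' n w : ℕ} (hc : 1 < c) (hε : 0 < ε)
    (hr : (1 : ℝ) ≤ m + m') (hw : (w : ℝ) ≤ (m / (m + m') - ε) * n) :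
    K * (c ^ w) ^ (m + m') / (c ^ n) ^ m ≤ K * (c ^ (-ε)) ^ n := by
  have hc0 : 0 < c := zero_lt_one.trans hc
  rw [mul_div_assoc]
  refine mul_le_mul_of_nonneg_left ?_ (Nat.cast_nonneg K)
  rw [← pow_mul, ← pow_mul, ← Real.rpow_natCast, ← Real.rpow_natCast, ← Real.rpow_natCast,
    ← Real.rpow_mul hc0.le, ← Real.rpow_sub hc0]
  refine Real.rpow_le_rpow_of_exponent_le hc.le ?_
  push_cast
  generalize (m + m' : ℝ) = r at hr hw ⊢
  have hr0 : 0 < r := by linarith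
  have h6 := mul_le_mul_of_nonneg_right hw hr0.le
  have h7 : (m / r - ε) * n * r = m * n - r * ε * n := by
    field_simp
  have h8 : ε * n ≤ r * ε * n := by
    rw [mul_assoc]
    exact le_mul_of_one_le_left (by positivity) hr
  linarith

theorem density_alignment_failure_le {F κ : Type} [Field F] [Finite F] [Field κ] [Algebra κ F]
    [FiniteDimensional κ F] {K d m m' : ℕ} {Q : Type} [Finite Q]
    (e : (Fin m ⊕ Fin m') ⊕ Q ≃ Fin d) {ε δ : ℝ} (hε : 0 < ε) (hr : (1 : ℝ) ≤ m + m')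
    (hδ : (d + 2 * K * (m + m') + 1) * ε ≤ δ)
    (hH : ∀ H : Fin K → Matrix Q (Fin m ⊕ Fin m') F, ∃ W U : Submodule κ F, W ≤ U ∧
      (∀ k q j, ∀ w ∈ W, H k q j * w ∈ U) ∧
      (Module.finrank κ U : ℝ) ≤ (1 + ε) * Module.finrank κ W ∧
      (m / (m + m') - ε - ε) * Module.finrank κ F ≤ Module.finrank κ W ∧
      (Module.finrank κ W : ℝ) ≤ (m / (m + m') - ε) * Module.finrank κ F) :
    density (fun Λ : Instance F K d (fun _ => m) (fun _ => m') =>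
      (∀ k, IsUnit ((Λ.equivBlocks e).1 k)) ∧ ¬ optimalCost Λ ≤ (m : ℝ) * d / (m + m') + δ) ≤
      K * ((Nat.card κ : ℝ) ^ (-ε)) ^ Module.finrank κ F := by
  have : Finite κ := Finite.of_injective _ (algebraMap κ F).injective
  have hκ : (1 : ℝ) < Nat.card κ := by exact_mod_cast Finite.one_lt_card
  have hn : (0 : ℝ) < Module.finrank κ F := by exact_mod_cast Module.finrank_pos
  have hmr : (m : ℝ) / (m + m') ≤ 1 :=
    div_le_one_of_le₀ (by linarith [(Nat.cast_nonneg m' : (0 : ℝ) ≤ m')]) (by linarith)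
  have : Finite (Matrix Q (Fin m ⊕ Fin m') F) :=
    inferInstanceAs (Finite (Q → Fin m ⊕ Fin m' → F))
  -- The subspaces are fixed as functions of `H` alone, so that on each fibre of constant `H` the
  -- union bound over `T` meets a fixed `W`.
  choose W U hWU hHU hU hWl hWu using hH
  let E : (Fin K → Matrix (Fin m ⊕ Fin m') (Fin m ⊕ Fin m') F) ×
      (Fin K → Matrix Q (Fin m ⊕ Fin m') F) → Prop := fun P =>
    ∃ k, ∃ b : Fin m' → F, b ≠ 0 ∧ ∀ j, (P.1 k).mulVec (Sum.elim 0 b) j ∈ (W P.2 : Set F)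
  let G : (Fin K → Matrix (Fin m ⊕ Fin m') (Fin m ⊕ Fin m') F) ×
      (Fin K → Matrix Q (Fin m ⊕ Fin m') F) → Prop := fun P =>
    (∀ k, IsUnit (P.1 k)) ∧ E (P.1, fun k => P.2 k * (P.1 k)⁻¹)
  have hG : ∀ Λ : Instance F K d (fun _ => m) (fun _ => m'),
      ((∀ k, IsUnit ((Λ.equivBlocks e).1 k)) ∧
        ¬ optimalCost Λ ≤ (m : ℝ) * d / (m + m') + δ) → G (Λ.equivBlocks e) := by
    rintro Λ ⟨hT, hc⟩
    refine ⟨hT, ?_⟩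
    by_contra hE
    refine hc ?_
    set H := fun k => (Λ.equivBlocks e).2 k * ((Λ.equivBlocks e).1 k)⁻¹
    refine (optimalCost_le_of_alignment e Λ (W H) (U H) (hWU H) hT (hHU H) fun k b hb => ?_).trans
      (alignment_cost_le (Nat.cast_nonneg d) (Nat.cast_nonneg K) hε (by linarith) hmr hn hδ
        (hU H) (hWl H) (hWu H))
    by_contra hb0
    exact hE ⟨k, b, hb0, hb⟩
  calc _ ≤ density (fun Λ : Instance F K d (fun _ => m) (fun _ => m') => G (Λ.equivBlocks e)) :=
        density_mono hG
    _ = density G := density_comp_equiv (Instance.equivBlocks e) G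
    _ ≤ density E := density_isUnit_and_le E
    _ ≤ _ := by
        refine density_prod_le E fun H => ?_
        refine (density_exists_mulVec_mem_le (K := K) (m := m) (m' := m') (W H : Set F)).trans ?_
        have hcW : Nat.card (W H : Set F) = Nat.card κ ^ Module.finrank κ (W H) :=
          Module.natCard_eq_pow_finrank (K := κ) (V := W H)
        rw [hcW, Module.natCard_eq_pow_finrank (K := κ) (V := F), Nat.cast_pow, Nat.cast_pow]
        exact alignment_failure_le hκ hε hr (hWu H)

/-- Asymptotically almost all instances with equal dimensions for all users allow alignment. -/
theorem aasLe_alignment (p : ℕ) [Fact p.Prime] (K : ℕ) {d m m' : ℕ} (hm : 0 < m)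
    (hd : m + m' ≤ d) {δ : ℝ} (hδ : 0 < δ) :
    AasLe p K d (fun _ => m) (fun _ => m') ((m : ℝ) * d / (m + m') + δ) := by
  have hm1 : (1 : ℝ) ≤ m := by exact_mod_cast hm
  have hm' : (0 : ℝ) ≤ m' := Nat.cast_nonneg m'
  have hr1 : (1 : ℝ) ≤ m + m' := by linarith
  have hmr : (m : ℝ) / (m + m') ≤ 1 := div_le_one_of_le₀ (by linarith) (by linarith)
  have hD : (0 : ℝ) < d + 2 * K * (m + m') + 1 := by positivity
  obtain ⟨ε, hε, hε1, hε2⟩ : ∃ ε : ℝ, 0 < ε ∧ ε ≤ m / (m + m') ∧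
      (d + 2 * K * (m + m') + 1) * ε ≤ δ := by
    refine ⟨min (m / (m + m')) (δ / (d + 2 * K * (m + m') + 1)), by positivity,
      min_le_left _ _, ?_⟩
    rw [← le_div_iff₀' hD]
    exact min_le_right _ _
  -- The extra index `none` stands for multiplication by `1` and yields `W ≤ U`. Taking `ρ` below `m
  -- / (m + m')` by `ε` makes the failure probability decay like `p^(-ε n)`.
  obtain ⟨n₀, hn₀⟩ := exists_almost_invariant (ZMod p)
    (Option (Fin K × Fin (d - (m + m')) × (Fin m ⊕ Fin m'))) hε (ρ := m / (m + m') - ε)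
    (by linarith) (by linarith)
  let e : (Fin m ⊕ Fin m') ⊕ Fin (d - (m + m')) ≃ Fin d :=
    ((Equiv.sumCongr finSumFinEquiv (Equiv.refl _)).trans finSumFinEquiv).trans
      (finCongr (by omega))
  have hbad : Tendsto (fun n => density (fun Λ :
      Instance (GaloisField p n) K d (fun _ => m) (fun _ => m') =>
      (∀ k, IsUnit ((Λ.equivBlocks e).1 k)) ∧ ¬ optimalCost Λ ≤ (m : ℝ) * d / (m + m') + δ))
      atTop (𝓝 0) := by
    refine squeeze_zero' (Eventually.of_forall fun _ => density_nonneg _) ?_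
      (tendsto_alignment_failure p K hε)
    filter_upwards [eventually_ge_atTop n₀, eventually_ne_atTop 0] with n hn hn0
    have hrank := GaloisField.finrank p hn0
    have h := density_alignment_failure_le (F := GaloisField p n) (κ := ZMod p) (K := K) e hε hr1
      hε2 fun H => by
        obtain ⟨W, U, h1, h2⟩ := hn₀ (GaloisField p n) (by rwa [hrank])
          (fun t => t.elim 1 fun t => H t.1 t.2.1 t.2.2)
        exact ⟨W, U, fun w hw => by simpa using h1 none w hw,
          fun k q j w hw => h1 (some (k, q, j)) w hw, h2⟩
    rwa [hrank, Nat.card_zmod] at h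
  refine tendsto_density_of_not _ ?_
  have hsum := (tendsto_density_not _ (tendsto_density_isUnit_equivBlocks p K e)).add hbad
  rw [add_zero] at hsum
  refine squeeze_zero (fun _ => density_nonneg _) (fun n => ?_) hsum
  refine le_trans (density_mono fun Λ hΛ => ?_) (density_or_le _ _)
  exact (em (∀ k, IsUnit ((Λ.equivBlocks e).1 k))).symm.imp_right fun hT => ⟨hT, hΛ⟩

theorem upperCost_le_alignment (p : ℕ) [Fact p.Prime] (K : ℕ) [NeZero K] (d : ℕ)
    (m m' : Fin K → ℕ) :
    upperCost p K d m m' ≤ (maxOf m : ℝ) * d / ((maxOf m : ℝ) + minOf m') := by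
  have hmax : ∀ k, m k ≤ maxOf m := fun k => Finset.le_sup' m (Finset.mem_univ k)
  have hmin : ∀ k, minOf m' ≤ m' k := fun k => Finset.inf'_le m' (Finset.mem_univ k)
  generalize maxOf m = M at hmax ⊢
  generalize minOf m' = M' at hmin ⊢
  rcases Nat.eq_zero_or_pos M with rfl | hM
  · have h0 : ∑ k, (m k : ℝ) = 0 :=
      Finset.sum_eq_zero fun k _ => by exact_mod_cast Nat.le_zero.1 (hmax k)
    simpa [h0] using (aasLe_sum p K d m m').upperCost_le
  have hM0 : (0 : ℝ) < M := by exact_mod_cast hM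
  have hM'0 : (0 : ℝ) ≤ M' := Nat.cast_nonneg _
  rcases le_total (M + M') d with hd | hd
  · refine le_of_forall_pos_le_add fun δ hδ => ?_
    exact ((aasLe_alignment p K hM hd hδ).mono hmax hmin).upperCost_le
  -- No square block fits strictly inside `d` rows here, but the simpler scheme suffices: `(d - M')
  -- (M + M') ≤ M d` amounts to `M' (d - M - M') ≤ 0`.
  · refine (aasLe_sub p K d m m' (min_le_left d M')
      fun k => (min_le_right d M').trans (hmin k)).upperCost_le.trans ?_
    rw [le_div_iff₀ (by positivity)]
    have hd' : (d : ℝ) ≤ M + M' := by exact_mod_cast hd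
    rcases le_total d M' with h | h
    · rw [min_eq_left h, sub_self, zero_mul]
      positivity
    · rw [min_eq_right h]
      nlinarith

theorem upperCost_le_sub (p : ℕ) [Fact p.Prime] (K : ℕ) [NeZero K] (d : ℕ) (m m' : Fin K → ℕ) :
    upperCost p K d m m' ≤ max 0 ((d : ℝ) - minOf m') := by
  have hmin : ∀ k, minOf m' ≤ m' k := fun k => Finset.inf'_le m' (Finset.mem_univ k)
  refine (aasLe_sub p K d m m' (min_le_left d (minOf m'))
    fun k => (min_le_right d _).trans (hmin k)).upperCost_le.trans_eq ?_
  rw [Nat.cast_min, ← max_sub_sub_left, sub_self]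

end LCBC

theorem corollary1 (p : ℕ) [Fact p.Prime] (K : ℕ) [NeZero K] (d : ℕ) (m m' : Fin K → ℕ) :
    (Finset.univ : Finset (Finset (Fin K))).sup' Finset.univ_nonempty
        (fun 𝒦 => min ((d : ℝ) - ∑ k ∈ 𝒦, (m' k : ℝ)) (∑ k ∈ 𝒦, (m k : ℝ)))
      ≤ LCBC.lowerCost p K d m m' ∧
    LCBC.upperCost p K d m m' ≤
      min ((LCBC.maxOf m : ℝ) * d / ((LCBC.maxOf m : ℝ) + LCBC.minOf m'))
        (min (max 0 ((d : ℝ) - LCBC.minOf m')) (∑ k, (m k : ℝ))) := by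
  exact ⟨Finset.sup'_le _ _ fun 𝒦 _ => LCBC.le_lowerCost p K d m m' 𝒦,
    le_min (LCBC.upperCost_le_alignment p K d m m')
      (le_min (LCBC.upperCost_le_sub p K d m m') (LCBC.aasLe_sum p K d m m').upperCost_le)⟩
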